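/- Let $G$ be a finite group and let $\omega\in Z^{3}(G,\mathrm{U}(1))$ be a normalized 3-cocycle (trivial $G$-action), i.e. $\omega(g,h,k)=1$ if one of $g,h,k$ is $1$, and $\omega(g,h,k)\,\omega(g,hk,l)\,\omega(h,k,l)=\omega(gh,k,l)\,\omega(g,h,kl)$ for all $g,h,k,l\in G$. Then there exists an infinite discrete metric space $X$ with bounded geometry and property A such that, for every separable infinite-dimensional complex Hilbert space $H$, there is an $\omega$-anomalous action of $G$ on the Roe corona $C^{*}(X)/\mathcal{K}$. Here: * $X$ has bounded geometry if for every $R>0$ there is $N$ such that every ball of radius $R$ in $X$ has at most $N$ points. * $X$ has property A if for all $\epsilon>0$ and $R>0$ there are finite nonempty sets $A_x\subseteq X\times\mathbb{N}$ ($x\in X$) and a constant $S$ such that $A_x\subseteq B_S(x)\times\mathbb{N}$ for all $x$, and, whenever $d(x,y)\le R$, $A_x\cap A_y\neq\varnothing$ and $|A_x\Delta A_y|/|A_x\cap A_y|\le\epsilon$. * For $x\in X$ let $P_x$ be the projection of $\ell^2(X,H)$ onto the functions supported at $x$. The Roe algebra $C^*(X)$ is the norm closure in $B(\ell^2(X,H))$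 of the set of operators $T$ that are locally compact ($P_yTP_x$ is compact for all $x,y$) and have finite propagation (there is $R>0$ such that $P_yTP_x\neq0$ implies $d(x,y)<R$). $\mathcal{K}$ is the ideal of compact operators on $\ell^2(X,H)$. * An $\omega$-anomalous action of $G$ on a C*-algebra $B$ consists of $*$-automorphisms $\alpha_g\in\mathrm{Aut}(B)$ ($g\in G$) and unitaries $m_{g,h}\in M(B)$ of the multiplier algebra ($g,h\in G$) such that $m_{g,h}\,\alpha_g(\alpha_h(x))=\alpha_{gh}(x)\,m_{g,h}$ for all $x\in B$, and $\omega(g,h,k)\,m_{gh,k}\,m_{g,h}=m_{g,hk}\,\alpha_g(m_{h,k})$ for all $g,h,k\in G$, where $\alpha_g$ is extended canonically to $M(B)$. -/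

import Mathlib

open scoped MultiplierAlgebra

noncomputable section

/-! ## Normalized three-cocycles with values in the circle group -/

/-- `ω : G × G × G → U(1)` is a normalized 3-cocycle for the trivial action of `G` on `U(1)`. -/
structure IsNormalizedThreeCocycle {G : Type*} [Group G] (ω : G → G → G → Circle) : Prop where
  map_one_left : ∀ h k, ω 1 h k = 1
  map_one_mid : ∀ g k, ω g 1 k = 1
  map_one_right : ∀ g h, ω g h 1 = 1
  cocycle : ∀ g h k l,
    ω g h k * ω g (h * k) l * ω h k l = ω (g * h) k l * ω g h (k * l)

/-! ## Anomalous actions on C⋆-algebras -/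

section Anomalous

variable {B : Type*} [NonUnitalCStarAlgebra B]

/-- A `*`-automorphism, as a continuous linear map. -/
def starAutCLM (α : B ≃⋆ₐ[ℂ] B) : B →L[ℂ] B where
  toFun := α
  map_add' := map_add α
  map_smul' := map_smul α
  cont := (AddMonoidHomClass.isometry_of_norm α (StarAlgEquiv.norm_map α)).continuous

@[simp] theorem starAutCLM_apply (α : B ≃⋆ₐ[ℂ] B) (b : B) : starAutCLM α b = α b := rfl

/-- The canonical extension of a `*`-automorphism `α` of `B` to the multiplier algebra `M(B)`: it
is characterised by `α(u) α(b) = α(u b)` and `α(b) α(u) = α(b u)` for `b ∈ B`. -/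
def extendToMultiplier (α : B ≃⋆ₐ[ℂ] B) (u : 𝓜(ℂ, B)) : 𝓜(ℂ, B) where
  fst := starAutCLM α ∘L u.fst ∘L starAutCLM α.symm
  snd := starAutCLM α ∘L u.snd ∘L starAutCLM α.symm
  central x y := by
    have h := congrArg α (u.central (α.symm x) (α.symm y))
    simpa using h

/-- `extendToMultiplier α` does extend `α`. -/
theorem extendToMultiplier_coe (α : B ≃⋆ₐ[ℂ] B) (b : B) :
    extendToMultiplier α (b : 𝓜(ℂ, B)) = ((α b : B) : 𝓜(ℂ, B)) := by
  apply DoubleCentralizer.ext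
  refine Prod.ext ?_ ?_ <;> ext x <;> simp [extendToMultiplier]

/-- An `ω`-anomalous action of `G` on the C⋆-algebra `B`: automorphisms `α g` of `B` and unitaries
`m g h` of the multiplier algebra `M(B)` such that `m g h` intertwines `α g ∘ α h` with `α (g h)`
and `m` satisfies the associativity relation up to the phase `ω`. -/
structure AnomalousAction {G : Type*} [Group G] (ω : G → G → G → Circle)
    (B : Type*) [NonUnitalCStarAlgebra B] where
  α : G → (B ≃⋆ₐ[ℂ] B)
  m : G → G → unitary 𝓜(ℂ, B)
  intertwine : ∀ (g h : G) (x : B),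
    (m g h : 𝓜(ℂ, B)) * ((α g (α h x) : B) : 𝓜(ℂ, B)) =
      ((α (g * h) x : B) : 𝓜(ℂ, B)) * (m g h : 𝓜(ℂ, B))
  associator : ∀ g h k : G,
    (ω g h k : ℂ) • ((m (g * h) k : 𝓜(ℂ, B)) * (m g h : 𝓜(ℂ, B))) =
      (m g (h * k) : 𝓜(ℂ, B)) * extendToMultiplier (α g) (m h k : 𝓜(ℂ, B))

end Anomalous

/-! ## Quotients of C⋆-algebras by closed two-sided `*`-ideals -/

/-- A closed two-sided `*`-ideal of a C⋆-algebra. -/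
structure ClosedStarIdeal (A : Type*) [NonUnitalCStarAlgebra A] extends Submodule ℂ A where
  isClosed' : IsClosed (toSubmodule : Set A)
  mul_mem_left' : ∀ (a : A) {x : A}, x ∈ toSubmodule → a * x ∈ toSubmodule
  mul_mem_right' : ∀ (a : A) {x : A}, x ∈ toSubmodule → x * a ∈ toSubmodule
  star_mem' : ∀ {x : A}, x ∈ toSubmodule → star x ∈ toSubmodule

namespace ClosedStarIdeal

variable {A : Type*} [NonUnitalCStarAlgebra A] (I : ClosedStarIdeal A)

/-- The ideal as a C⋆-subalgebra; only used to find an approximate unit in it. -/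
def toSubalg : NonUnitalStarSubalgebra ℂ A where
  toSubmodule := I.toSubmodule
  mul_mem' {a _} _ hb := I.mul_mem_left' a hb
  star_mem' h := I.star_mem' h

/-- The quotient C⋆-algebra `A / I`, with the quotient norm `‖a + I‖ = inf {‖a + x‖ : x ∈ I}`. -/
def Quotient : Type _ := A ⧸ I.toSubmodule

instance : IsClosed (I.toSubmodule : Set A) := I.isClosed'

instance : NormedAddCommGroup I.Quotient :=
  inferInstanceAs (NormedAddCommGroup (A ⧸ I.toSubmodule))

instance : NormedSpace ℂ I.Quotient :=
  inferInstanceAs (NormedSpace ℂ (A ⧸ I.toSubmodule))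

instance : CompleteSpace I.Quotient :=
  inferInstanceAs (CompleteSpace (A ⧸ I.toSubmodule))

/-- The quotient map. -/
def quotMap : A →ₗ[ℂ] I.Quotient := I.toSubmodule.mkQ

theorem quotMap_surjective : Function.Surjective I.quotMap := Submodule.Quotient.mk_surjective _

theorem quotMap_eq_iff {a b : A} : I.quotMap a = I.quotMap b ↔ a - b ∈ I.toSubmodule :=
  Submodule.Quotient.eq _

theorem norm_quotMap_le (a : A) : ‖I.quotMap a‖ ≤ ‖a‖ := Submodule.Quotient.norm_mk_le _ a

theorem exists_lift_lt (q : I.Quotient) {ε : ℝ} (hε : 0 < ε) :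
    ∃ a : A, I.quotMap a = q ∧ ‖a‖ < ‖q‖ + ε :=
  Submodule.Quotient.norm_mk_lt (S := I.toSubmodule) q hε

instance : Mul I.Quotient where
  mul := Quotient.map₂ (· * ·) (by
    intro a a' ha b b' hb
    have ha' : a - a' ∈ I.toSubmodule := (Submodule.quotientRel_def _).1 ha
    have hb' : b - b' ∈ I.toSubmodule := (Submodule.quotientRel_def _).1 hb
    refine (Submodule.quotientRel_def _).2 ?_
    have : a * b - a' * b' = (a - a') * b + a' * (b - b') := by
      rw [sub_mul, mul_sub]; abel
    rw [this]
    exact add_mem (I.mul_mem_right' _ ha') (I.mul_mem_left' _ hb'))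

@[simp] theorem quotMap_mul (a b : A) : I.quotMap (a * b) = I.quotMap a * I.quotMap b := rfl

instance : Star I.Quotient where
  star := Quotient.map star (by
    intro a a' ha
    have ha' : a - a' ∈ I.toSubmodule := (Submodule.quotientRel_def _).1 ha
    refine (Submodule.quotientRel_def _).2 ?_
    rw [← star_sub]
    exact I.star_mem' ha')

@[simp] theorem quotMap_star (a : A) : I.quotMap (star a) = star (I.quotMap a) := rfl

instance : NonUnitalRing I.Quotient where
  left_distrib x y z := by
    obtain ⟨a, rfl⟩ := I.quotMap_surjective x
    obtain ⟨b, rfl⟩ := I.quotMap_surjective y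
    obtain ⟨c, rfl⟩ := I.quotMap_surjective z
    simp only [← map_add, ← quotMap_mul, mul_add]
  right_distrib x y z := by
    obtain ⟨a, rfl⟩ := I.quotMap_surjective x
    obtain ⟨b, rfl⟩ := I.quotMap_surjective y
    obtain ⟨c, rfl⟩ := I.quotMap_surjective z
    simp only [← map_add, ← quotMap_mul, add_mul]
  zero_mul x := by
    obtain ⟨a, rfl⟩ := I.quotMap_surjective x
    rw [← map_zero I.quotMap, ← quotMap_mul, zero_mul]
  mul_zero x := by
    obtain ⟨a, rfl⟩ := I.quotMap_surjective x
    rw [← map_zero I.quotMap, ← quotMap_mul, mul_zero]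
  mul_assoc x y z := by
    obtain ⟨a, rfl⟩ := I.quotMap_surjective x
    obtain ⟨b, rfl⟩ := I.quotMap_surjective y
    obtain ⟨c, rfl⟩ := I.quotMap_surjective z
    simp only [← quotMap_mul, mul_assoc]

theorem norm_mul_le' (x y : I.Quotient) : ‖x * y‖ ≤ ‖x‖ * ‖y‖ := by
  have key : ∀ ε : ℝ, 0 < ε → ‖x * y‖ ≤ (‖x‖ + ε) * (‖y‖ + ε) := by
    intro ε hε
    obtain ⟨a, rfl, ha⟩ := I.exists_lift_lt x hε
    obtain ⟨b, rfl, hb⟩ := I.exists_lift_lt y hε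
    rw [← quotMap_mul]
    calc ‖I.quotMap (a * b)‖ ≤ ‖a * b‖ := I.norm_quotMap_le _
      _ ≤ ‖a‖ * ‖b‖ := norm_mul_le _ _
      _ ≤ _ := by gcongr
  have hlim : Filter.Tendsto (fun ε : ℝ => (‖x‖ + ε) * (‖y‖ + ε)) (nhdsWithin 0 (Set.Ioi 0))
      (nhds (‖x‖ * ‖y‖)) := by
    have : Continuous fun ε : ℝ => (‖x‖ + ε) * (‖y‖ + ε) := by fun_prop
    simpa using (this.tendsto 0).mono_left nhdsWithin_le_nhds
  exact ge_of_tendsto hlim (by filter_upwards [self_mem_nhdsWithin] with ε hε using key ε hε)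

instance : NonUnitalNormedRing I.Quotient where
  __ := (inferInstance : NonUnitalRing I.Quotient)
  __ := (inferInstance : NormedAddCommGroup I.Quotient)
  norm_mul_le := I.norm_mul_le'

instance : StarRing I.Quotient where
  star_involutive x := by
    obtain ⟨a, rfl⟩ := I.quotMap_surjective x
    simp only [← quotMap_star, star_star]
  star_mul x y := by
    obtain ⟨a, rfl⟩ := I.quotMap_surjective x
    obtain ⟨b, rfl⟩ := I.quotMap_surjective y
    simp only [← quotMap_star, ← quotMap_mul, star_mul]
  star_add x y := by
    obtain ⟨a, rfl⟩ := I.quotMap_surjective x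
    obtain ⟨b, rfl⟩ := I.quotMap_surjective y
    simp only [← quotMap_star, ← map_add, star_add]

instance : StarModule ℂ I.Quotient where
  star_smul c x := by
    obtain ⟨a, rfl⟩ := I.quotMap_surjective x
    simp only [← quotMap_star, ← map_smul, star_smul]

instance : IsScalarTower ℂ I.Quotient I.Quotient where
  smul_assoc c x y := by
    obtain ⟨a, rfl⟩ := I.quotMap_surjective x
    obtain ⟨b, rfl⟩ := I.quotMap_surjective y
    simp only [smul_eq_mul, ← map_smul, ← quotMap_mul, smul_mul_assoc]

instance : SMulCommClass ℂ I.Quotient I.Quotient where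
  smul_comm c x y := by
    obtain ⟨a, rfl⟩ := I.quotMap_surjective x
    obtain ⟨b, rfl⟩ := I.quotMap_surjective y
    simp only [smul_eq_mul, ← map_smul, ← quotMap_mul, mul_smul_comm]

/-- In a unital C⋆-algebra, `‖1 - b⋆b‖ ≤ 1` for a contraction `b`. -/
theorem norm_one_sub_star_mul_self_le {C : Type*} [CStarAlgebra C] (b : C)
    (hb : ‖star b * b‖ ≤ 1) : ‖1 - star b * b‖ ≤ 1 := by
  let _ := CStarAlgebra.spectralOrder C
  let _ := CStarAlgebra.spectralOrderedRing C
  have h0 : 0 ≤ star b * b := star_mul_self_nonneg b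
  have h1 : star b * b ≤ 1 := (CStarAlgebra.norm_le_one_iff_of_nonneg _ h0).1 hb
  exact (CStarAlgebra.norm_le_one_iff_of_nonneg _ (sub_nonneg.2 h1)).2 (sub_le_self _ h0)

open Unitization in
/-- If `e = b⋆b` is a positive contraction, then
`‖a - a e‖² ≤ ‖a⋆a + x‖ + ‖x - e x‖` for all `x`. -/
theorem norm_sub_mul_sq_le (a x b : A) (hb : ‖star b * b‖ ≤ 1) :
    ‖a - a * (star b * b)‖ ^ 2 ≤ ‖star a * a + x‖ + ‖x - (star b * b) * x‖ := by
  set e := star b * b with he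
  have hse : star e = e := by simp [he]
  set u : Unitization ℂ A := 1 - (e : Unitization ℂ A) with hu
  have hu1 : ‖u‖ ≤ 1 := by
    have := norm_one_sub_star_mul_self_le (b : Unitization ℂ A)
      (by rw [← inr_star, ← inr_mul, norm_inr]; exact hb)
    rwa [← inr_star, ← inr_mul] at this
  have hsu : star u = u := by
    rw [hu, star_sub, star_one, ← inr_star, hse]
  have h1 : ((a - a * e : A) : Unitization ℂ A) = a * u := by
    rw [hu, mul_sub, mul_one, inr_sub, inr_mul]
  have h2 : ((x - e * x : A) : Unitization ℂ A) = u * x := by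
    rw [hu, sub_mul, one_mul, inr_sub, inr_mul]
  have h3 : star ((a : Unitization ℂ A) * u) * (a * u) =
      u * ((star a * a + x : A) : Unitization ℂ A) * u - (u * x) * u := by
    rw [star_mul, hsu, inr_add, inr_mul, inr_star]
    noncomm_ring
  rw [sq, ← norm_inr (𝕜 := ℂ) (a := a - a * e), h1, ← CStarRing.norm_star_mul_self, h3,
    ← norm_inr (𝕜 := ℂ) (a := x - e * x), h2, ← norm_inr (𝕜 := ℂ) (a := star a * a + x)]
  set y : Unitization ℂ A := ((star a * a + x : A) : Unitization ℂ A)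
  calc ‖u * y * u - u * x * u‖ ≤ ‖u * y * u‖ + ‖u * x * u‖ := norm_sub_le _ _
    _ ≤ ‖u‖ * ‖y‖ * ‖u‖ + ‖u * (x : Unitization ℂ A)‖ * ‖u‖ := by
        gcongr
        · exact (norm_mul_le _ _).trans (by gcongr; exact norm_mul_le _ _)
        · exact norm_mul_le _ _
    _ ≤ 1 * ‖y‖ * 1 + ‖u * (x : Unitization ℂ A)‖ * 1 := by gcongr
    _ = _ := by ring

theorem norm_quotMap_sq_le (a x : A) (hx : x ∈ I.toSubmodule) :
    ‖I.quotMap a‖ ^ 2 ≤ ‖star a * a + x‖ := by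
  have : IsClosed (I.toSubalg : Set A) := I.isClosed'
  let _ := CStarAlgebra.spectralOrder I.toSubalg
  let _ := CStarAlgebra.spectralOrderedRing I.toSubalg
  have hl := CStarAlgebra.increasingApproximateUnit I.toSubalg
  set l := CStarAlgebra.approximateUnit I.toSubalg
  let x' : I.toSubalg := ⟨x, hx⟩
  have hlim : Filter.Tendsto (fun e : I.toSubalg => ‖star a * a + x‖ + ‖x - (e : A) * x‖) l
      (nhds ‖star a * a + x‖) := by
    have h1 : Filter.Tendsto (fun e : I.toSubalg => ‖x' - e * x'‖) l (nhds ‖x' - x'‖) :=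
      (tendsto_const_nhds.sub (hl.tendsto_mul_right x')).norm
    rw [sub_self, norm_zero] at h1
    simpa using h1.const_add ‖star a * a + x‖
  refine ge_of_tendsto hlim ?_
  filter_upwards [hl.eventually_nonneg, hl.eventually_norm] with e he0 he1
  obtain ⟨b, hb⟩ := CStarAlgebra.nonneg_iff_eq_star_mul_self.1 he0
  have hb' : (e : A) = star (b : A) * (b : A) := by rw [hb]; rfl
  have hn : ‖star (b : A) * (b : A)‖ ≤ 1 := by rw [← hb']; exact he1
  have hq : I.quotMap a = I.quotMap (a - a * (e : A)) := by
    rw [I.quotMap_eq_iff, sub_sub_cancel]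
    exact I.mul_mem_left' a e.2
  rw [hq]
  calc ‖I.quotMap (a - a * (e : A))‖ ^ 2 ≤ ‖a - a * (e : A)‖ ^ 2 := by
        gcongr; exact I.norm_quotMap_le _
    _ ≤ _ := by rw [hb']; exact norm_sub_mul_sq_le a x b hn

instance : CStarRing I.Quotient where
  norm_mul_self_le q := by
    obtain ⟨a, rfl⟩ := I.quotMap_surjective q
    refine le_of_forall_pos_le_add fun ε hε => ?_
    obtain ⟨c, hc, hcn⟩ := I.exists_lift_lt (star (I.quotMap a) * I.quotMap a) hε
    have hx : c - star a * a ∈ I.toSubmodule := I.quotMap_eq_iff.1 hc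
    have := I.norm_quotMap_sq_le a _ hx
    rw [add_sub_cancel, sq] at this
    exact this.trans hcn.le

instance : NonUnitalCStarAlgebra I.Quotient where

end ClosedStarIdeal

/-! ## Coarse geometry -/

/-- Bounded geometry: for each `R > 0` there is `N` such that every `R`-ball has at most `N`
points. -/
class BoundedGeometry (X : Type*) [MetricSpace X] : Prop where
  bound : ∀ R : ℝ, 0 < R → ∃ N : ℕ, ∀ x : X,
    (Metric.closedBall x R).Finite ∧ (Metric.closedBall x R).ncard ≤ N

/-- Yu's property A. -/
def PropertyA (X : Type*) [MetricSpace X] : Prop :=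
  ∀ ε : ℝ, 0 < ε → ∀ R : ℝ, 0 < R → ∃ (A : X → Set (X × ℕ)) (S : ℝ),
    (∀ x, (A x).Finite ∧ (A x).Nonempty) ∧
    (∀ x, ∀ p ∈ A x, p.1 ∈ Metric.closedBall x S) ∧
    (∀ x y, dist x y ≤ R → (A x ∩ A y).Nonempty ∧
      ((symmDiff (A x) (A y)).ncard : ℝ) / ((A x ∩ A y).ncard : ℝ) ≤ ε)

/-! ## The Roe algebra -/

section Roe

variable (X : Type*) (H : Type*) [NormedAddCommGroup H] [InnerProductSpace ℂ H]

/-- The Hilbert space `ℓ²(X, H)`. -/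
abbrev EllTwo := lp (fun _ : X => H) 2

variable {X H}

open Classical in
/-- The orthogonal projection `P_x` of `ℓ²(X, H)` onto the functions supported at `x`. -/
def siteProj (x : X) : EllTwo X H →L[ℂ] EllTwo X H :=
  lp.singleContinuousLinearMap ℂ (fun _ : X => H) 2 x ∘L lp.evalCLM ℂ (fun _ : X => H) 2 x

open Classical in
theorem siteProj_apply (x : X) (η : EllTwo X H) (y : X) :
    siteProj x η y = if y = x then η y else 0 := by
  by_cases h : y = x
  · subst h
    simp [siteProj]
    rfl
  · simp [siteProj, h]

/-- `T` is locally compact: every block `P_y T P_x` is a compact operator. -/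
def IsLocallyCompactOp (T : EllTwo X H →L[ℂ] EllTwo X H) : Prop :=
  ∀ x y : X, IsCompactOperator (siteProj y ∘L T ∘L siteProj x)

/-- `T` has finite propagation: `P_y T P_x ≠ 0` only if `d(x, y) < R`. -/
def HasFinitePropagation [MetricSpace X] (T : EllTwo X H →L[ℂ] EllTwo X H) : Prop :=
  ∃ R : ℝ, 0 < R ∧ ∀ x y : X, siteProj y ∘L T ∘L siteProj x ≠ 0 → dist x y < R

theorem siteProj_adjoint [CompleteSpace H] (x : X) : star (siteProj (H := H) x) = siteProj x := by
  classical
  rw [ContinuousLinearMap.star_eq_adjoint, eq_comm, ContinuousLinearMap.eq_adjoint_iff]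
  intro ξ η
  rw [lp.inner_eq_tsum, lp.inner_eq_tsum]
  refine tsum_congr fun y => ?_
  rw [siteProj_apply, siteProj_apply]
  split_ifs <;> simp

theorem siteProj_block_star [CompleteSpace H] (T : EllTwo X H →L[ℂ] EllTwo X H) (x y : X) :
    siteProj y ∘L star T ∘L siteProj x = star (siteProj x ∘L T ∘L siteProj y) := by
  change siteProj y * (star T * siteProj x) = star (siteProj x * (T * siteProj y))
  rw [star_mul, star_mul, siteProj_adjoint, siteProj_adjoint, mul_assoc]

/-- The adjoint of a compact operator on a Hilbert space is compact. -/
theorem IsCompactOperator.star_clm {E : Type*} [NormedAddCommGroup E] [InnerProductSpace ℂ E]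
    [CompleteSpace E] {T : E →L[ℂ] E} (hT : IsCompactOperator T) :
    IsCompactOperator (star T : E →L[ℂ] E) := by
  have hTT : IsCompactOperator (T * star T : E →L[ℂ] E) := hT.comp_clm (star T)
  have hsub : TotallyBounded ((T * star T : E →L[ℂ] E) '' Metric.closedBall 0 1) :=
    (IsCompactOperator.isCompact_closure_image_closedBall (𝕜₁ := ℂ)
      (f := ((T * star T : E →L[ℂ] E) : E →ₗ[ℂ] E)) hTT 1).totallyBounded.subset subset_closure
  have key : ∀ z : E, ‖star T z‖ ^ 2 ≤ ‖(T * star T) z‖ * ‖z‖ := by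
    intro z
    have h1 : inner ℂ (star T z) (star T z) = inner ℂ ((T * star T) z) z := by
      rw [ContinuousLinearMap.star_eq_adjoint, ContinuousLinearMap.adjoint_inner_right]
      rfl
    rw [inner_self_eq_norm_sq_to_K] at h1
    calc ‖star T z‖ ^ 2 = ‖((‖star T z‖ : ℂ)) ^ 2‖ := by simp
      _ = ‖inner ℂ ((T * star T) z) z‖ := by rw [← h1]; rfl
      _ ≤ _ := norm_inner_le_norm _ _
  have htb : TotallyBounded ((star T : E →L[ℂ] E) '' Metric.closedBall 0 1) := by
    rw [Metric.totallyBounded_iff]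
    intro ε hε
    obtain ⟨t, hts, htf, hcov⟩ := Metric.finite_approx_of_totallyBounded hsub (ε ^ 2 / 4)
      (by positivity)
    obtain ⟨t', ht's, ht'f, rfl⟩ := Set.exists_subset_image_finite_and.1 ⟨t, hts, htf, rfl⟩
    refine ⟨(star T : E →L[ℂ] E) '' t', ht'f.image _, ?_⟩
    rintro _ ⟨x, hx, rfl⟩
    have hmem := hcov (Set.mem_image_of_mem _ hx)
    simp only [Set.mem_iUnion, Set.mem_image, exists_prop] at hmem ⊢
    obtain ⟨_, ⟨y, hy, rfl⟩, hxy⟩ := hmem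
    refine ⟨_, ⟨y, hy, rfl⟩, ?_⟩
    rw [Metric.mem_ball, dist_eq_norm, ← map_sub] at hxy ⊢
    have hx1 : ‖x‖ ≤ 1 := by simpa using hx
    have hy1 : ‖y‖ ≤ 1 := by simpa using ht's hy
    have h2 : ‖x - y‖ ≤ 2 := (norm_sub_le _ _).trans (by linarith)
    have h3 := key (x - y)
    have h4 : ‖star T (x - y)‖ ^ 2 < ε ^ 2 := by
      nlinarith [norm_nonneg ((T * star T) (x - y)), norm_nonneg (x - y)]
    exact lt_of_pow_lt_pow_left₀ 2 hε.le h4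
  exact (isCompactOperator_iff_isCompact_closure_image_closedBall
    ((star T : E →L[ℂ] E) : E →ₗ[ℂ] E) zero_lt_one).2
    (htb.closure.isCompact_of_isClosed isClosed_closure)

/-- With bounded geometry, `P_y S T P_x = ∑ P_y S P_z T P_x`, the sum being over a finite set. -/
theorem exists_block_mul [MetricSpace X] [BoundedGeometry X]
    {S T : EllTwo X H →L[ℂ] EllTwo X H} (hT : HasFinitePropagation T) (x : X) :
    ∃ F : Finset X, ∀ y, siteProj y ∘L (S * T) ∘L siteProj x =
      ∑ z ∈ F, (siteProj y ∘L S ∘L siteProj z) ∘L (siteProj z ∘L T ∘L siteProj x) := by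
  classical
  obtain ⟨R, hR, hprop⟩ := hT
  obtain ⟨N, hN⟩ := BoundedGeometry.bound (X := X) R hR
  refine ⟨(hN x).1.toFinset, fun y => ?_⟩
  have hsum : T ∘L siteProj x =
      ∑ z ∈ (hN x).1.toFinset, siteProj z ∘L T ∘L siteProj x := by
    ext η w
    simp only [sum_apply, lp.coeFn_sum, Finset.sum_apply,
      ContinuousLinearMap.comp_apply, siteProj_apply, Finset.sum_ite_eq]
    split_ifs with hw
    · rfl
    · by_contra hne
      apply hw
      have : siteProj w ∘L T ∘L siteProj x ≠ 0 := by
        intro h0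
        apply hne
        have := congrArg (fun U : EllTwo X H →L[ℂ] EllTwo X H => U η w) h0
        simpa [siteProj_apply] using this
      rw [Set.Finite.mem_toFinset, Metric.mem_closedBall, dist_comm]
      exact (hprop x w this).le
  ext η : 1
  have h1 := congrArg (fun U : EllTwo X H →L[ℂ] EllTwo X H => siteProj y (S (U η))) hsum
  have h2 : ∀ (z : X) (ξ : EllTwo X H), siteProj z (siteProj z ξ) = siteProj z ξ := by
    intro z ξ
    ext w
    simp only [siteProj_apply]
    split_ifs <;> rfl
  simpa [sum_apply, h2] using h1

variable (X H) [CompleteSpace H]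

/-- The `*`-algebra of locally compact operators of finite propagation on `ℓ²(X, H)`. -/
def algebraicRoe [MetricSpace X] [BoundedGeometry X] :
    NonUnitalStarSubalgebra ℂ (EllTwo X H →L[ℂ] EllTwo X H) where
  carrier := {T | IsLocallyCompactOp T ∧ HasFinitePropagation T}
  zero_mem' := ⟨fun x y => by simpa using isCompactOperator_zero, 1, one_pos, by simp⟩
  add_mem' := by
    rintro S T ⟨hS, R, hR, hSR⟩ ⟨hT, R', _, hTR⟩
    have hadd : ∀ x y : X, siteProj y ∘L (S + T) ∘L siteProj x =
        siteProj y ∘L S ∘L siteProj x + siteProj y ∘L T ∘L siteProj x := fun x y => by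
      rw [ContinuousLinearMap.add_comp, ContinuousLinearMap.comp_add]
    refine ⟨fun x y => ?_, max R R', lt_max_of_lt_left hR, fun x y h => ?_⟩
    · rw [hadd]
      exact (hS x y).add (hT x y)
    · by_contra hd
      rw [not_lt, max_le_iff] at hd
      refine h ?_
      rw [hadd, not_not.1 (mt (hSR x y) hd.1.not_gt), not_not.1 (mt (hTR x y) hd.2.not_gt),
        add_zero]
  smul_mem' := by
    rintro c T ⟨hT, R, hR, hTR⟩
    have hsmul : ∀ x y : X, siteProj y ∘L (c • T) ∘L siteProj x =
        c • (siteProj y ∘L T ∘L siteProj x) := fun x y => by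
      rw [ContinuousLinearMap.smul_comp, ContinuousLinearMap.comp_smul]
    refine ⟨fun x y => ?_, R, hR, fun x y h => hTR x y fun h0 => h ?_⟩
    · rw [hsmul]
      exact (hT x y).smul c
    · rw [hsmul, h0, smul_zero]
  mul_mem' := by
    rintro S T ⟨hS, R, hR, hSR⟩ ⟨hT, R', hR', hTR⟩
    refine ⟨fun x y => ?_, R + R', by positivity, fun x y h => ?_⟩
    · obtain ⟨F, hF⟩ := exists_block_mul (S := S) (T := T) ⟨R', hR', hTR⟩ x
      rw [hF y]
      exact Submodule.sum_mem (compactOperator (RingHom.id ℂ) (EllTwo X H) (EllTwo X H))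
        fun z _ => (hT x z).clm_comp (siteProj y ∘L S ∘L siteProj z)
    · obtain ⟨F, hF⟩ := exists_block_mul (S := S) (T := T) ⟨R', hR', hTR⟩ x
      rw [hF y] at h
      obtain ⟨z, -, hz⟩ := Finset.exists_ne_zero_of_sum_ne_zero h
      have h1 : dist z y < R := hSR z y fun h0 => hz (by rw [h0, ContinuousLinearMap.zero_comp])
      have h2 : dist x z < R' := hTR x z fun h0 => hz (by rw [h0, ContinuousLinearMap.comp_zero])
      linarith [dist_triangle x z y]
  star_mem' := by
    rintro T ⟨hT, R, hR, hTR⟩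
    refine ⟨fun x y => ?_, R, hR, fun x y h => ?_⟩
    · rw [siteProj_block_star]
      exact (hT y x).star_clm
    · rw [siteProj_block_star] at h
      rw [dist_comm]
      exact hTR y x fun h0 => h (by rw [h0, star_zero])

/-- The Roe algebra `C⋆(X)`: the norm closure of the locally compact operators of finite
propagation in `B(ℓ²(X, H))`. -/
def roeAlgebra [MetricSpace X] [BoundedGeometry X] :
    NonUnitalStarSubalgebra ℂ (EllTwo X H →L[ℂ] EllTwo X H) :=
  (algebraicRoe X H).topologicalClosure

instance [MetricSpace X] [BoundedGeometry X] :
    IsClosed (roeAlgebra X H : Set (EllTwo X H →L[ℂ] EllTwo X H)) :=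
  (algebraicRoe X H).isClosed_topologicalClosure

/-- The ideal `𝒦` of compact operators on `ℓ²(X, H)`, as an ideal of the Roe algebra (every compact
operator is a norm limit of operators `P_F T P_F`, `F ⊆ X` finite, so it lies in `C⋆(X)`). -/
def roeCompacts [MetricSpace X] [BoundedGeometry X] : ClosedStarIdeal (roeAlgebra X H) where
  carrier := {T | IsCompactOperator (T : EllTwo X H →L[ℂ] EllTwo X H)}
  zero_mem' := isCompactOperator_zero
  add_mem' := fun h h' => h.add h'
  smul_mem' := fun c _ h => h.smul c
  isClosed' := by
    have h : IsClosed {f : EllTwo X H →L[ℂ] EllTwo X H | IsCompactOperator f} :=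
      isClosed_setOfPred_isCompactOperator
    exact h.preimage continuous_subtype_val
  mul_mem_left' := fun a _ h => h.clm_comp (a : EllTwo X H →L[ℂ] EllTwo X H)
  mul_mem_right' := fun a _ h => h.comp_clm (a : EllTwo X H →L[ℂ] EllTwo X H)
  star_mem' := fun h => IsCompactOperator.star_clm h

/-- The Roe corona `C⋆(X) / 𝒦`. -/
abbrev RoeCorona [MetricSpace X] [BoundedGeometry X] : Type _ := (roeCompacts X H).Quotient

end Roe

end

noncomputable section

/-! ## Permutation and diagonal unitaries on `ℓ²(X, H)` -/

section Operators

variable {X : Type*} {H : Type*} [NormedAddCommGroup H] [InnerProductSpace ℂ H]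

/-! The class of `ω` dies when coefficients are enlarged from U(1) to the U(1)-valued functions on
`G` with translation action: by the cocycle identity, the cochain `(g, h) ↦ (a ↦ ω a⁻¹ g h)` is an
explicit trivialisation. It therefore suffices to find a space on whose Roe corona `G` acts and for
which the functions on `G` give unitary multipliers commuting with the corona and translated by the
action.

Take as `X` one copy of `ℕ` for each element of `G`, the copies drifting apart, and let `G` permute
these legs by left translation. This is an action by isometries, so conjugation by permutation
operators gives a genuine action on the Roe algebra and on the corona. A function constant on each
leg acts diagonally. At a fixed scale only finitely many pairs of points lie on different legs, so
the commutator of such a function with an operator in the algebraic Roe algebra has finitely many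
nonzero blocks, all compact; passing to the closure, it commutes with the Roe algebra modulo `𝒦`
(`isCompactOperator_commutator`). With `m g h` the function `x ↦ ω (π x)⁻¹ g h`, where `π x` is the
leg of `x`, intertwining is commutation and the associator is the cocycle identity
(`nonempty_anomalousAction_roeCorona`).

Finitely many legs mean linear growth, whence bounded geometry and property A with large balls as
witnesses (`Spider.propertyA`). -/

theorem memℓp_weightedPerm (σ : Equiv.Perm X) (f : X → Circle) (η : EllTwo X H) :
    Memℓp (fun x => f x • η (σ.symm x)) 2 := by
  have h : Summable fun x => ‖η x‖ ^ (2 : ENNReal).toReal := (lp.memℓp η).summable (by norm_num)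
  refine memℓp_gen ?_
  simpa only [Circle.smul_def, norm_smul, Circle.norm_coe, one_mul, Function.comp_def] using
    σ.symm.summable_iff.2 h

/-- The weighted permutation operator `(W η)(x) = f(x) η(σ⁻¹ x)`. -/
def weightedPerm (σ : Equiv.Perm X) (f : X → Circle) : EllTwo X H →L[ℂ] EllTwo X H :=
  LinearMap.mkContinuous
    { toFun := fun η => ⟨fun x => f x • η (σ.symm x), memℓp_weightedPerm σ f η⟩
      map_add' := fun η ξ => by ext x; exact smul_add (f x) _ _
      map_smul' := fun c η => by ext x; exact smul_comm (f x) c _ } 1 (fun η => by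
      rw [one_mul, lp.norm_eq_tsum_rpow (by norm_num), lp.norm_eq_tsum_rpow (by norm_num)]
      refine le_of_eq (congrArg (· ^ (1 / (2 : ENNReal).toReal)) ?_)
      rw [← Equiv.tsum_eq σ.symm fun x => ‖η x‖ ^ (2 : ENNReal).toReal]
      refine tsum_congr fun x => ?_
      simp only [LinearMap.coe_mk, AddHom.coe_mk, Circle.smul_def, norm_smul, Circle.norm_coe,
        one_mul])

@[simp] theorem weightedPerm_apply (σ : Equiv.Perm X) (f : X → Circle) (η : EllTwo X H) (x : X) :
    weightedPerm σ f η x = f x • η (σ.symm x) := rfl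

theorem weightedPerm_mul (σ τ : Equiv.Perm X) (f g : X → Circle) :
    (weightedPerm σ f * weightedPerm τ g : EllTwo X H →L[ℂ] EllTwo X H) =
      weightedPerm (σ * τ) (fun x => f x * g (σ.symm x)) := by
  ext η x
  simp [mul_smul, Equiv.Perm.mul_def]

theorem weightedPerm_one : (weightedPerm 1 1 : EllTwo X H →L[ℂ] EllTwo X H) = 1 := by
  ext η x
  simp [Equiv.Perm.one_def]

theorem star_weightedPerm [CompleteSpace H] (σ : Equiv.Perm X) (f : X → Circle) :
    star (weightedPerm σ f : EllTwo X H →L[ℂ] EllTwo X H) =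
      weightedPerm σ⁻¹ (fun x => (f (σ x))⁻¹) := by
  rw [ContinuousLinearMap.star_eq_adjoint, eq_comm, ContinuousLinearMap.eq_adjoint_iff]
  intro ξ η
  rw [lp.inner_eq_tsum, lp.inner_eq_tsum,
    ← Equiv.tsum_eq σ fun x => inner ℂ (ξ x) (weightedPerm σ f η x)]
  refine tsum_congr fun x => ?_
  simp [Equiv.Perm.inv_def, Circle.smul_def, inner_smul_left, ← Circle.coe_inv_eq_conj]

variable (H) in
/-- The operator on `ℓ²(X, H)` permuting the coordinates by `σ`. -/
def permOp (σ : Equiv.Perm X) : EllTwo X H →L[ℂ] EllTwo X H := weightedPerm σ 1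

variable (H) in
/-- The operator on `ℓ²(X, H)` multiplying coordinatewise by `f`. -/
def diagOp (f : X → Circle) : EllTwo X H →L[ℂ] EllTwo X H := weightedPerm 1 f

@[simp] theorem permOp_apply (σ : Equiv.Perm X) (η : EllTwo X H) (x : X) :
    permOp H σ η x = η (σ.symm x) := by
  simp [permOp]

@[simp] theorem diagOp_apply (f : X → Circle) (η : EllTwo X H) (x : X) :
    diagOp H f η x = f x • η x := rfl

theorem diagOp_one : diagOp H (1 : X → Circle) = 1 := weightedPerm_one

theorem diagOp_mul (f g : X → Circle) : diagOp H (f * g) = diagOp H f * diagOp H g := by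
  ext η x
  simp [mul_smul]

theorem diagOp_const_mul (c : Circle) (f : X → Circle) :
    diagOp H (fun x => c * f x) = (c : ℂ) • diagOp H f := by
  ext η x
  simp [Circle.smul_def, mul_smul]

theorem star_diagOp [CompleteSpace H] (f : X → Circle) : star (diagOp H f) = diagOp H f⁻¹ :=
  star_weightedPerm 1 f

variable (H) in
/-- The unitary on `ℓ²(X, H)` permuting the coordinates by `σ`. -/
def permUnitary [CompleteSpace H] :
    Equiv.Perm X →* unitary (EllTwo X H →L[ℂ] EllTwo X H) where
  toFun σ := ⟨permOp H σ, by
    rw [permOp, Unitary.mem_iff, star_weightedPerm, weightedPerm_mul, weightedPerm_mul]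
    constructor <;> simp [← weightedPerm_one, Pi.one_def]⟩
  map_one' := Subtype.ext weightedPerm_one
  map_mul' σ τ := Subtype.ext (by simp [permOp, weightedPerm_mul, Pi.one_def])

@[simp] theorem coe_permUnitary [CompleteSpace H] (σ : Equiv.Perm X) :
    (permUnitary H σ : EllTwo X H →L[ℂ] EllTwo X H) = permOp H σ := rfl

/-- This covariance is the source of the translation of functions by the action on multipliers. -/
theorem permOp_mul_diagOp (σ : Equiv.Perm X) (f : X → Circle) :
    permOp H σ * diagOp H f = diagOp H (f ∘ σ.symm) * permOp H σ := by
  ext η x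
  simp

theorem permOp_mul_siteProj (σ : Equiv.Perm X) (x : X) :
    permOp H σ * siteProj x = siteProj (σ x) * permOp H σ := by
  classical
  ext η y
  simp [siteProj_apply, Equiv.symm_apply_eq]

theorem diagOp_mul_siteProj (f : X → Circle) (x : X) :
    diagOp H f * siteProj x = (f x : ℂ) • siteProj x := by
  classical
  ext η y
  simp only [mul_apply_eq_comp, diagOp_apply, siteProj_apply, smul_apply,
    lp.coeFn_smul, Pi.smul_apply]
  split_ifs with h
  · rw [h, Circle.smul_def]
  · simp

theorem siteProj_mul_diagOp (f : X → Circle) (x : X) :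
    siteProj x * diagOp H f = (f x : ℂ) • siteProj x := by
  classical
  ext η y
  simp only [mul_apply_eq_comp, diagOp_apply, siteProj_apply, smul_apply,
    lp.coeFn_smul, Pi.smul_apply]
  split_ifs with h
  · rw [h, Circle.smul_def]
  · simp

end Operators

/-! ### Block decomposition of operators on `ℓ²(X, H)` -/

section Blocks

variable {X : Type*} {H : Type*} [NormedAddCommGroup H] [InnerProductSpace ℂ H]

open Classical in
theorem siteProj_mul_siteProj (x y : X) :
    (siteProj x * siteProj y : EllTwo X H →L[ℂ] EllTwo X H) =
      if x = y then siteProj x else 0 := by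
  ext η z
  by_cases hxy : x = y
  · subst hxy
    simp only [mul_apply_eq_comp, siteProj_apply, if_true]
    split_ifs <;> rfl
  · simp only [mul_apply_eq_comp, siteProj_apply, if_neg hxy]
    split_ifs with h1 h2
    · exact absurd (h1.symm.trans h2) hxy
    · rfl
    · rfl

/-- An operator on `ℓ²(X, H)` is determined by its blocks. -/
theorem eq_of_blocks {S T : EllTwo X H →L[ℂ] EllTwo X H}
    (h : ∀ x y, siteProj y * S * siteProj x = siteProj y * T * siteProj x) : S = T := by
  classical
  refine lp.ext_continuousLinearMap (by norm_num) fun x => ?_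
  ext v y
  have h1 : siteProj x (lp.single 2 x v : EllTwo X H) = lp.single 2 x v := by
    ext z
    rw [siteProj_apply, lp.single_apply]
    split_ifs with hz <;> simp [hz]
  have := congrArg (fun U : EllTwo X H →L[ℂ] EllTwo X H => U (lp.single 2 x v) y) (h x y)
  simpa [siteProj_apply, h1] using this

/-- An operator with finitely many nonzero blocks, all of them compact, is compact. -/
theorem isCompactOperator_of_finite_blocks {T : EllTwo X H →L[ℂ] EllTwo X H}
    (hT : IsLocallyCompactOp T)
    (hfin : {p : X × X | siteProj p.2 * T * siteProj p.1 ≠ 0}.Finite) : IsCompactOperator T := by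
  classical
  -- Orthogonality of the site projections leaves at most one summand in each block, so both sides
  -- have equal blocks.
  have key : T = ∑ p ∈ hfin.toFinset, siteProj p.2 * T * siteProj p.1 := by
    refine eq_of_blocks fun x y => ?_
    have hterm : ∀ p : X × X, siteProj y * (siteProj p.2 * T * siteProj p.1) * siteProj x =
        if p = (x, y) then siteProj y * T * siteProj x else 0 := by
      rintro ⟨a, b⟩
      have : siteProj y * (siteProj b * T * siteProj a) * siteProj x =
          (siteProj y * siteProj b) * T * (siteProj a * siteProj x) := by simp only [mul_assoc]
      rw [this, siteProj_mul_siteProj, siteProj_mul_siteProj]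
      by_cases h : a = x ∧ b = y
      · obtain ⟨rfl, rfl⟩ := h
        simp
      · rw [if_neg (mt Prod.ext_iff.1 h)]
        rcases not_and_or.1 h with h | h
        · rw [if_neg h, mul_zero]
        · rw [if_neg (Ne.symm h : ¬ y = b), zero_mul, zero_mul]
    rw [Finset.mul_sum, Finset.sum_mul, Finset.sum_congr rfl fun p _ => hterm p,
      Finset.sum_ite_eq']
    split_ifs with h
    · rfl
    · simpa using h
  rw [key]
  exact Submodule.sum_mem (compactOperator (RingHom.id ℂ) (EllTwo X H) (EllTwo X H))
    fun p _ => hT p.1 p.2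

end Blocks

/-! ## Maps induced on quotient C⋆-algebras -/

namespace ClosedStarIdeal

variable {A : Type*} [NonUnitalCStarAlgebra A] (I : ClosedStarIdeal A)

/-- A bounded linear map preserving `I` descends to the quotient by `I`. -/
def quotCLM (φ : A →L[ℂ] A) (h : ∀ a ∈ I.toSubmodule, φ a ∈ I.toSubmodule) :
    I.Quotient →L[ℂ] I.Quotient :=
  LinearMap.mkContinuous (I.toSubmodule.mapQ I.toSubmodule φ h) ‖φ‖ (fun q => by
    refine le_of_forall_pos_le_add fun ε hε => ?_
    -- The `+ 1` covers `φ = 0`; the error after applying `φ` is then at most `ε`.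
    have hδ : 0 < ε / (‖φ‖ + 1) := by positivity
    obtain ⟨a, rfl, ha⟩ := I.exists_lift_lt q hδ
    calc ‖I.quotMap (φ a)‖ ≤ ‖φ a‖ := I.norm_quotMap_le _
      _ ≤ ‖φ‖ * ‖a‖ := φ.le_opNorm a
      _ ≤ ‖φ‖ * (‖I.quotMap a‖ + ε / (‖φ‖ + 1)) := by gcongr
      _ = ‖φ‖ * ‖I.quotMap a‖ + ε * (‖φ‖ / (‖φ‖ + 1)) := by ring
      _ ≤ ‖φ‖ * ‖I.quotMap a‖ + ε * 1 := by
        gcongr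
        exact (div_le_one (by positivity)).2 (by linarith)
      _ = _ := by rw [mul_one])

/-- A `*`-automorphism preserving `I` descends to the quotient by `I`. -/
def quotAut (φ : A ≃⋆ₐ[ℂ] A) (h : ∀ a ∈ I.toSubmodule, φ a ∈ I.toSubmodule)
    (h' : ∀ a ∈ I.toSubmodule, φ.symm a ∈ I.toSubmodule) : I.Quotient ≃⋆ₐ[ℂ] I.Quotient where
  toFun := I.quotCLM (starAutCLM φ) h
  invFun := I.quotCLM (starAutCLM φ.symm) h'
  left_inv q := by
    obtain ⟨a, rfl⟩ := I.quotMap_surjective q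
    exact congrArg I.quotMap (φ.symm_apply_apply a)
  right_inv q := by
    obtain ⟨a, rfl⟩ := I.quotMap_surjective q
    exact congrArg I.quotMap (φ.apply_symm_apply a)
  map_mul' p q := by
    obtain ⟨a, rfl⟩ := I.quotMap_surjective p
    obtain ⟨b, rfl⟩ := I.quotMap_surjective q
    exact congrArg I.quotMap (map_mul φ a b)
  map_add' := map_add _
  map_star' q := by
    obtain ⟨a, rfl⟩ := I.quotMap_surjective q
    exact congrArg I.quotMap (map_star φ a)
  map_smul' := map_smul _

end ClosedStarIdeal

/-! ## Restriction of ambient automorphisms and multipliers to a subalgebra -/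

namespace NonUnitalStarSubalgebra

variable {C : Type*} [CStarAlgebra C] (A : NonUnitalStarSubalgebra ℂ C)

/-- A `*`-automorphism of `C` preserving the subalgebra `A` restricts to `A`. -/
def restrictAut (φ : C ≃⋆ₐ[ℂ] C) (h : ∀ a ∈ A, φ a ∈ A) (h' : ∀ a ∈ A, φ.symm a ∈ A) :
    A ≃⋆ₐ[ℂ] A where
  toFun a := ⟨φ a, h a a.2⟩
  invFun a := ⟨φ.symm a, h' a a.2⟩
  left_inv a := by simp
  right_inv a := by simp
  map_mul' a b := by ext; simp
  map_add' a b := by ext; simp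
  map_star' a := by ext; simp [map_star]
  map_smul' c a := by ext; simp

/-- Left multiplication on the subalgebra `A` by an element of its left idealizer. -/
def mulLeftCLM (T : C) (h : ∀ a ∈ A, T * a ∈ A) : A →L[ℂ] A :=
  LinearMap.mkContinuous
    { toFun := fun a => ⟨T * a, h a a.2⟩
      map_add' := fun a b => Subtype.ext (mul_add T a b)
      map_smul' := fun c a => Subtype.ext (mul_smul_comm c T a) } ‖T‖ fun a => norm_mul_le T a

/-- Right multiplication on the subalgebra `A` by an element of its right idealizer. -/
def mulRightCLM (T : C) (h : ∀ a ∈ A, a * T ∈ A) : A →L[ℂ] A :=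
  LinearMap.mkContinuous
    { toFun := fun a => ⟨a * T, h a a.2⟩
      map_add' := fun a b => Subtype.ext (add_mul (a : C) b T)
      map_smul' := fun c a => Subtype.ext (smul_mul_assoc c (a : C) T) } ‖T‖ fun a =>
        (norm_mul_le (a : C) T).trans_eq (mul_comm _ _)

@[simp] theorem coe_mulLeftCLM (T : C) (h : ∀ a ∈ A, T * a ∈ A) (a : A) :
    (A.mulLeftCLM T h a : C) = T * a := rfl

@[simp] theorem coe_mulRightCLM (T : C) (h : ∀ a ∈ A, a * T ∈ A) (a : A) :
    (A.mulRightCLM T h a : C) = a * T := rfl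

end NonUnitalStarSubalgebra

/-! ## Permutation automorphisms and diagonal multipliers of the Roe corona -/

section Corona

variable {X : Type*} [MetricSpace X] [BoundedGeometry X]
  {H : Type*} [NormedAddCommGroup H] [InnerProductSpace ℂ H] [CompleteSpace H]

theorem diagOp_mul_mem_algebraicRoe (f : X → Circle) {T : EllTwo X H →L[ℂ] EllTwo X H}
    (hT : T ∈ algebraicRoe X H) : diagOp H f * T ∈ algebraicRoe X H := by
  obtain ⟨hc, R, hR, hp⟩ := hT
  have hblock : ∀ x y : X, siteProj y ∘L (diagOp H f * T) ∘L siteProj x =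
      (f y : ℂ) • (siteProj y ∘L T ∘L siteProj x) := fun x y => by
    change siteProj y * ((diagOp H f * T) * siteProj x) =
      (f y : ℂ) • (siteProj y * (T * siteProj x))
    rw [mul_assoc, ← mul_assoc (siteProj y), siteProj_mul_diagOp, smul_mul_assoc]
  refine ⟨fun x y => ?_, R, hR, fun x y h => hp x y fun h0 => h ?_⟩
  · rw [hblock]
    exact (hc x y).smul (f y : ℂ)
  · rw [hblock, h0, smul_zero]

/-- Reduces every invariance claim about the Roe algebra to operators of finite propagation, where
it can be read off the blocks. -/
theorem mem_roeAlgebra_of_maps {φ : (EllTwo X H →L[ℂ] EllTwo X H) → EllTwo X H →L[ℂ] EllTwo X H}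
    (hφ : Continuous φ) (h : ∀ T ∈ algebraicRoe X H, φ T ∈ algebraicRoe X H)
    {T : EllTwo X H →L[ℂ] EllTwo X H} (hT : T ∈ roeAlgebra X H) : φ T ∈ roeAlgebra X H :=
  map_mem_closure (s := (algebraicRoe X H : Set (EllTwo X H →L[ℂ] EllTwo X H))) hφ hT h

theorem diagOp_mul_mem_roeAlgebra (f : X → Circle) (T : EllTwo X H →L[ℂ] EllTwo X H)
    (hT : T ∈ roeAlgebra X H) : diagOp H f * T ∈ roeAlgebra X H :=
  mem_roeAlgebra_of_maps (φ := fun T => diagOp H f * T) (continuous_const_mul _)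
    (fun _ => diagOp_mul_mem_algebraicRoe f) hT

theorem mul_diagOp_mem_roeAlgebra (f : X → Circle) (T : EllTwo X H →L[ℂ] EllTwo X H)
    (hT : T ∈ roeAlgebra X H) : T * diagOp H f ∈ roeAlgebra X H := by
  have := star_mem (diagOp_mul_mem_roeAlgebra f⁻¹ (star T) (star_mem hT))
  rwa [star_mul, star_star, star_diagOp, inv_inv] at this

/-- If at each scale `f` separates only finitely many pairs of points, then
multiplication by `f` commutes with the Roe algebra modulo compact operators. -/
theorem isCompactOperator_commutator (f : X → Circle)
    (hf : ∀ R : ℝ, {p : X × X | dist p.1 p.2 < R ∧ f p.1 ≠ f p.2}.Finite)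
    {T : EllTwo X H →L[ℂ] EllTwo X H} (hT : T ∈ roeAlgebra X H) :
    IsCompactOperator (diagOp H f * T - T * diagOp H f) := by
  let D : EllTwo X H →L[ℂ] EllTwo X H := diagOp H f
  -- The operators whose commutator with `D` is compact form a norm-closed set, so finite
  -- propagation may be assumed.
  have hclosed : IsClosed
      {S : EllTwo X H →L[ℂ] EllTwo X H | IsCompactOperator (D * S - S * D)} := by
    have h : IsClosed {S : EllTwo X H →L[ℂ] EllTwo X H | IsCompactOperator S} :=
      isClosed_setOfPred_isCompactOperator
    have hcont : Continuous fun S : EllTwo X H →L[ℂ] EllTwo X H => D * S - S * D := by fun_prop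
    exact h.preimage hcont
  refine closure_minimal (s := (algebraicRoe X H : Set (EllTwo X H →L[ℂ] EllTwo X H)))
    ?_ hclosed hT
  rintro S ⟨hc, R, hR, hp⟩
  -- Since `f` acts as a scalar at each site, a block of the commutator is a multiple of the block
  -- of `S`; it vanishes if `f x = f y` or if `x` and `y` are farther apart than the propagation.
  have hblock : ∀ x y : X, siteProj y * (D * S - S * D) * siteProj x =
      ((f y : ℂ) - f x) • (siteProj y ∘L S ∘L siteProj x) := fun x y => by
    change siteProj y * (diagOp H f * S - S * diagOp H f) * siteProj x =
      ((f y : ℂ) - f x) • (siteProj y * (S * siteProj x))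
    rw [mul_sub, sub_mul, ← mul_assoc, siteProj_mul_diagOp, mul_assoc _ (S * _), mul_assoc S,
      diagOp_mul_siteProj, sub_smul]
    simp only [smul_mul_assoc, mul_smul_comm, mul_assoc]
  refine isCompactOperator_of_finite_blocks (fun x y => ?_) ((hf R).subset ?_)
  · change IsCompactOperator
      (siteProj y * ((D * S - S * D) * siteProj x) : EllTwo X H →L[ℂ] EllTwo X H)
    rw [← mul_assoc, hblock]
    exact (hc x y).smul ((f y : ℂ) - f x)
  · rintro ⟨x, y⟩ h
    simp only [Set.mem_ofPred_eq] at h ⊢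
    rw [hblock] at h
    refine ⟨hp x y fun h0 => h (by rw [h0, smul_zero]),
      fun hxy => h (by rw [hxy, sub_self, zero_smul])⟩

variable (H) in
/-- The multiplier of the Roe corona given by multiplication by `f`. -/
def coronaDiag (f : X → Circle) : 𝓜(ℂ, RoeCorona X H) where
  fst := (roeCompacts X H).quotCLM
    ((roeAlgebra X H).mulLeftCLM (diagOp H f) (diagOp_mul_mem_roeAlgebra f))
    fun _ h => IsCompactOperator.clm_comp h (diagOp H f)
  snd := (roeCompacts X H).quotCLM
    ((roeAlgebra X H).mulRightCLM (diagOp H f) (mul_diagOp_mem_roeAlgebra f))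
    fun _ h => IsCompactOperator.comp_clm h (diagOp H f)
  central p q := by
    obtain ⟨a, rfl⟩ := (roeCompacts X H).quotMap_surjective p
    obtain ⟨b, rfl⟩ := (roeCompacts X H).quotMap_surjective q
    exact congrArg (roeCompacts X H).quotMap (Subtype.ext (mul_assoc _ _ _))

theorem coronaDiag_fst (f : X → Circle) (a : roeAlgebra X H) :
    (coronaDiag H f).fst ((roeCompacts X H).quotMap a) = (roeCompacts X H).quotMap
      ((roeAlgebra X H).mulLeftCLM (diagOp H f) (diagOp_mul_mem_roeAlgebra f) a) := rfl

theorem coronaDiag_snd (f : X → Circle) (a : roeAlgebra X H) :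
    (coronaDiag H f).snd ((roeCompacts X H).quotMap a) = (roeCompacts X H).quotMap
      ((roeAlgebra X H).mulRightCLM (diagOp H f) (mul_diagOp_mem_roeAlgebra f) a) := rfl

/-- Multipliers of the Roe corona are determined by their values on lifts. -/
theorem corona_multiplier_ext {u v : 𝓜(ℂ, RoeCorona X H)}
    (h₁ : ∀ a, u.fst ((roeCompacts X H).quotMap a) = v.fst ((roeCompacts X H).quotMap a))
    (h₂ : ∀ a, u.snd ((roeCompacts X H).quotMap a) = v.snd ((roeCompacts X H).quotMap a)) :
    u = v := by
  refine DoubleCentralizer.ext _ _ _ _ (Prod.ext ?_ ?_)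
  · ext q
    obtain ⟨a, rfl⟩ := (roeCompacts X H).quotMap_surjective q
    exact h₁ a
  · ext q
    obtain ⟨a, rfl⟩ := (roeCompacts X H).quotMap_surjective q
    exact h₂ a

theorem coronaDiag_one : coronaDiag H (1 : X → Circle) = 1 := by
  refine corona_multiplier_ext (fun a => ?_) fun a => ?_
  · rw [coronaDiag_fst]
    exact congrArg (roeCompacts X H).quotMap (Subtype.ext (by simp [diagOp_one]))
  · rw [coronaDiag_snd]
    exact congrArg (roeCompacts X H).quotMap (Subtype.ext (by simp [diagOp_one]))

theorem coronaDiag_mul (f g : X → Circle) :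
    coronaDiag H (f * g) = coronaDiag H f * coronaDiag H g := by
  refine corona_multiplier_ext (fun a => ?_) fun a => ?_
  · rw [coronaDiag_fst]
    exact congrArg (roeCompacts X H).quotMap (Subtype.ext (by simp [diagOp_mul, mul_assoc]))
  · rw [coronaDiag_snd]
    exact congrArg (roeCompacts X H).quotMap (Subtype.ext (by simp [diagOp_mul, mul_assoc]))

theorem coronaDiag_const_mul (c : Circle) (f : X → Circle) :
    coronaDiag H (fun x => c * f x) = (c : ℂ) • coronaDiag H f := by
  refine corona_multiplier_ext (fun a => ?_) fun a => ?_
  · rw [coronaDiag_fst]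
    refine congrArg (roeCompacts X H).quotMap (Subtype.ext ?_)
    exact (congrArg (· * (a : EllTwo X H →L[ℂ] EllTwo X H)) (diagOp_const_mul c f)).trans
      (smul_mul_assoc _ _ _)
  · rw [coronaDiag_snd]
    refine congrArg (roeCompacts X H).quotMap (Subtype.ext ?_)
    exact (congrArg ((a : EllTwo X H →L[ℂ] EllTwo X H) * ·) (diagOp_const_mul c f)).trans
      (mul_smul_comm _ _ _)

theorem star_coronaDiag (f : X → Circle) : star (coronaDiag H f) = coronaDiag H f⁻¹ := by
  refine corona_multiplier_ext (fun a => ?_) fun a => ?_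
  · refine congrArg (roeCompacts X H).quotMap (Subtype.ext ?_)
    change star (star (a : EllTwo X H →L[ℂ] EllTwo X H) * diagOp H f) = diagOp H f⁻¹ * a
    rw [star_mul, star_star, star_diagOp]
  · refine congrArg (roeCompacts X H).quotMap (Subtype.ext ?_)
    change star (diagOp H f * star (a : EllTwo X H →L[ℂ] EllTwo X H)) = a * diagOp H f⁻¹
    rw [star_mul, star_star, star_diagOp]

variable (H) in
/-- Multiplication by `f`, as a unitary multiplier of the Roe corona. -/
def coronaDiagUnitary (f : X → Circle) : unitary 𝓜(ℂ, RoeCorona X H) :=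
  ⟨coronaDiag H f, by
    rw [Unitary.mem_iff, star_coronaDiag, ← coronaDiag_mul, ← coronaDiag_mul, inv_mul_cancel,
      mul_inv_cancel, coronaDiag_one]
    exact ⟨rfl, rfl⟩⟩

theorem coronaDiag_fst_mul (f : X → Circle) (p q : RoeCorona X H) :
    (coronaDiag H f).fst (p * q) = (coronaDiag H f).fst p * q := by
  obtain ⟨a, rfl⟩ := (roeCompacts X H).quotMap_surjective p
  obtain ⟨b, rfl⟩ := (roeCompacts X H).quotMap_surjective q
  exact congrArg (roeCompacts X H).quotMap (Subtype.ext (mul_assoc _ _ _).symm)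

theorem coronaDiag_snd_mul (f : X → Circle) (p q : RoeCorona X H) :
    (coronaDiag H f).snd (p * q) = p * (coronaDiag H f).snd q := by
  obtain ⟨a, rfl⟩ := (roeCompacts X H).quotMap_surjective p
  obtain ⟨b, rfl⟩ := (roeCompacts X H).quotMap_surjective q
  exact congrArg (roeCompacts X H).quotMap (Subtype.ext (mul_assoc _ _ _))

/-- Compactness of commutators makes the left and right actions of `f` on the corona coincide; a
left action is right-linear and a right action left-linear, which gives commutation in the
multiplier algebra. -/
theorem coronaDiag_commute (f : X → Circle)
    (hf : ∀ R : ℝ, {p : X × X | dist p.1 p.2 < R ∧ f p.1 ≠ f p.2}.Finite) (q : RoeCorona X H) :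
    coronaDiag H f * (q : 𝓜(ℂ, RoeCorona X H)) = (q : 𝓜(ℂ, RoeCorona X H)) * coronaDiag H f := by
  have key : ∀ p : RoeCorona X H, (coronaDiag H f).fst p = (coronaDiag H f).snd p := fun p => by
    obtain ⟨b, rfl⟩ := (roeCompacts X H).quotMap_surjective p
    rw [coronaDiag_fst, coronaDiag_snd, ClosedStarIdeal.quotMap_eq_iff]
    exact isCompactOperator_commutator f hf b.2
  refine DoubleCentralizer.ext _ _ _ _ (Prod.ext ?_ ?_) <;> ext p
  · change (coronaDiag H f).fst (q * p) = q * (coronaDiag H f).fst p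
    rw [key, key, coronaDiag_snd_mul]
  · change (coronaDiag H f).snd p * q = (coronaDiag H f).snd (p * q)
    rw [← key, ← key, coronaDiag_fst_mul]

/-! ### Automorphisms of the corona induced by isometries -/

/-- Conjugation carries the block from `x` to `y` to the block from `σ x` to `σ y`; an isometry
leaves the propagation bound unchanged. -/
theorem conj_permUnitary_mem_algebraicRoe {σ : Equiv.Perm X} (hσ : Isometry σ)
    {T : EllTwo X H →L[ℂ] EllTwo X H} (hT : T ∈ algebraicRoe X H) :
    Unitary.conjStarAlgAut ℂ (EllTwo X H →L[ℂ] EllTwo X H) (permUnitary H σ) T ∈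
      algebraicRoe X H := by
  obtain ⟨hc, R, hR, hp⟩ := hT
  set U : EllTwo X H →L[ℂ] EllTwo X H := permOp H σ with hU
  have hright : ∀ x, siteProj (σ x) * U = U * siteProj x := fun x =>
    (permOp_mul_siteProj σ x).symm
  have hleft : ∀ x, star U * siteProj (σ x) = siteProj x * star U := fun x => by
    have := congrArg star (hright x)
    rwa [star_mul, star_mul, siteProj_adjoint, siteProj_adjoint] at this
  have hblock : ∀ x y : X, siteProj (σ y) ∘L (U * T * star U) ∘L siteProj (σ x) =
      U ∘L (siteProj y ∘L T ∘L siteProj x) ∘L star U := fun x y => by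
    change siteProj (σ y) * (U * T * star U * siteProj (σ x)) =
      U * (siteProj y * (T * siteProj x) * star U)
    rw [mul_assoc _ (star U), hleft, mul_assoc U, ← mul_assoc (siteProj (σ y)), hright]
    simp only [mul_assoc]
  rw [Unitary.conjStarAlgAut_apply, coe_permUnitary, ← hU]
  refine ⟨fun x y => ?_, R, hR, fun x y h => ?_⟩
  · rw [← σ.apply_symm_apply x, ← σ.apply_symm_apply y, hblock]
    exact ((hc _ _).comp_clm (star U)).clm_comp U
  · rw [← σ.apply_symm_apply x, ← σ.apply_symm_apply y, hblock] at h
    rw [← σ.apply_symm_apply x, ← σ.apply_symm_apply y, hσ.dist_eq]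
    exact hp _ _ fun h0 => h (by rw [h0]; simp)

theorem conj_permUnitary_mem_roeAlgebra {σ : Equiv.Perm X} (hσ : Isometry σ)
    (T : EllTwo X H →L[ℂ] EllTwo X H) (hT : T ∈ roeAlgebra X H) :
    Unitary.conjStarAlgAut ℂ (EllTwo X H →L[ℂ] EllTwo X H) (permUnitary H σ) T ∈
      roeAlgebra X H := by
  refine mem_roeAlgebra_of_maps ?_ (fun _ => conj_permUnitary_mem_algebraicRoe hσ) hT
  change Continuous fun T => permOp H σ * T * star (permOp H σ)
  fun_prop

theorem conj_symm_permUnitary_mem_roeAlgebra {σ : Equiv.Perm X} (hσ : Isometry σ)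
    (T : EllTwo X H →L[ℂ] EllTwo X H) (hT : T ∈ roeAlgebra X H) :
    (Unitary.conjStarAlgAut ℂ (EllTwo X H →L[ℂ] EllTwo X H) (permUnitary H σ)).symm T ∈
      roeAlgebra X H := by
  have h' : Isometry ⇑σ⁻¹ := hσ.right_inv σ.apply_symm_apply
  rw [Unitary.conjStarAlgAut_symm, Unitary.star_eq_inv, ← map_inv]
  exact conj_permUnitary_mem_roeAlgebra h' T hT

variable (H) in
/-- The automorphism of the Roe corona induced by an isometric permutation of the space. -/
def coronaPermAut (σ : Equiv.Perm X) (hσ : Isometry σ) : RoeCorona X H ≃⋆ₐ[ℂ] RoeCorona X H :=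
  (roeCompacts X H).quotAut
    ((roeAlgebra X H).restrictAut (Unitary.conjStarAlgAut ℂ _ (permUnitary H σ))
      (conj_permUnitary_mem_roeAlgebra hσ) (conj_symm_permUnitary_mem_roeAlgebra hσ))
    (fun _ h => (h.comp_clm (star (permOp H σ))).clm_comp
      (permOp H σ))
    (fun _ h => (h.comp_clm (permOp H σ)).clm_comp
      (star (permOp H σ)))

/-- The automorphisms compose strictly, so the whole anomaly will be carried by the multipliers. -/
theorem coronaPermAut_mul {σ τ : Equiv.Perm X} (hσ : Isometry σ) (hτ : Isometry τ)
    (hστ : Isometry (σ * τ : Equiv.Perm X)) (q : RoeCorona X H) :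
    coronaPermAut H (σ * τ) hστ q = coronaPermAut H σ hσ (coronaPermAut H τ hτ q) := by
  obtain ⟨a, rfl⟩ := (roeCompacts X H).quotMap_surjective q
  refine congrArg (roeCompacts X H).quotMap (Subtype.ext ?_)
  change Unitary.conjStarAlgAut ℂ _ (permUnitary H (σ * τ)) _ =
    Unitary.conjStarAlgAut ℂ _ (permUnitary H σ) (Unitary.conjStarAlgAut ℂ _ (permUnitary H τ) _)
  rw [map_mul, Unitary.conjStarAlgAut_mul_apply]

theorem extendToMultiplier_coronaPermAut (σ : Equiv.Perm X) (hσ : Isometry σ) (f : X → Circle) :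
    extendToMultiplier (coronaPermAut H σ hσ) (coronaDiag H f) =
      coronaDiag H (f ∘ σ.symm) := by
  set U : EllTwo X H →L[ℂ] EllTwo X H := permOp H σ with hU
  have hUU : U * star U = 1 := Unitary.mul_star_self_of_mem (permUnitary H σ).2
  have hcomm : U * diagOp H f = diagOp H (f ∘ σ.symm) * U :=
    permOp_mul_diagOp σ f
  have hconj : U * diagOp H f * star U = diagOp H (f ∘ σ.symm) := by
    rw [hcomm, mul_assoc, hUU, mul_one]
  refine corona_multiplier_ext (fun a => ?_) fun a => ?_
  · refine congrArg (roeCompacts X H).quotMap (Subtype.ext ?_)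
    -- The extended automorphism acts on a multiplier by undoing the conjugation on `a`, multiplying
    -- by `f`, and conjugating again.
    change U * (diagOp H f * (star U * a * U)) * star U = diagOp H (f ∘ σ.symm) * a
    rw [← hconj]
    simp only [mul_assoc, hUU, mul_one]
  · refine congrArg (roeCompacts X H).quotMap (Subtype.ext ?_)
    change U * ((star U * a * U) * diagOp H f) * star U = a * diagOp H (f ∘ σ.symm)
    rw [← hconj]
    simp only [← mul_assoc, hUU, one_mul]

/-- Suppose `G` acts by isometries on `X`, and `π : X → G` is an equivariant map whose fibres are
coarsely disjoint. Then every normalized 3-cocycle on `G` is the anomaly of an action on the Roe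
corona of `X`. -/
theorem nonempty_anomalousAction_roeCorona {G : Type*} [Group G] {ω : G → G → G → Circle}
    (hω : IsNormalizedThreeCocycle ω) (σ : G →* Equiv.Perm X) (hσ : ∀ g, Isometry (σ g))
    (π : X → G) (hπ : ∀ g x, π (σ g x) = g * π x)
    (hfin : ∀ R : ℝ, {p : X × X | dist p.1 p.2 < R ∧ π p.1 ≠ π p.2}.Finite) :
    Nonempty (AnomalousAction ω (RoeCorona X H)) := by
  have hα : ∀ (g h : G) (q : RoeCorona X H), coronaPermAut H (σ g) (hσ g)
      (coronaPermAut H (σ h) (hσ h) q) = coronaPermAut H (σ (g * h)) (hσ (g * h)) q := by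
    intro g h q
    have hστ : Isometry (σ g * σ h : Equiv.Perm X) := map_mul σ g h ▸ hσ (g * h)
    rw [← coronaPermAut_mul (hσ g) (hσ h) hστ]
    congr 2
    exact (map_mul σ g h).symm
  -- The first slot of `ω` holds the position on `G`. The inverse turns the left translation `π x ↦
  -- g⁻¹ * π x` into right multiplication `(π x)⁻¹ ↦ (π x)⁻¹ * g`, as the cocycle identity requires.
  refine ⟨⟨fun g => coronaPermAut H (σ g) (hσ g),
    fun g h => coronaDiagUnitary H fun x => ω (π x)⁻¹ g h, fun g h q => ?_, fun g h k => ?_⟩⟩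
  -- As the action is strict, intertwining says only that `m g h` commutes with the corona, and `m g
  -- h` is constant on the fibres of `π`.
  · rw [hα]
    refine coronaDiag_commute _ (fun R => (hfin R).subset ?_) _
    rintro p ⟨hp, hne⟩
    exact ⟨hp, fun h0 => hne (by rw [h0])⟩
  · change (ω g h k : ℂ) • (coronaDiag H _ * coronaDiag H _) =
      coronaDiag H _ * extendToMultiplier _ (coronaDiag H _)
    rw [extendToMultiplier_coronaPermAut, ← coronaDiag_mul, ← coronaDiag_mul,
      ← coronaDiag_const_mul]
    congr 1
    funext x
    have h1 : π ((σ g).symm x) = g⁻¹ * π x := by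
      have := hπ g ((σ g).symm x)
      rw [Equiv.apply_symm_apply] at this
      rw [this, inv_mul_cancel_left]
    -- The associator at the point `x` is exactly this instance of the cocycle identity.
    have h2 := hω.cocycle (π x)⁻¹ g h k
    simp only [Pi.mul_apply, Function.comp_apply, h1, mul_inv_rev, inv_inv]
    calc ω g h k * (ω (π x)⁻¹ (g * h) k * ω (π x)⁻¹ g h) =
        ω (π x)⁻¹ g h * ω (π x)⁻¹ (g * h) k * ω g h k := by ac_rfl
      _ = _ := by rw [h2, mul_comm]

end Corona

/-! ## Spiders -/

/-- The coarse disjoint union of copies of `ℕ` ("legs") indexed by `ι`. -/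
@[ext] structure Spider (ι : Type*) where
  /-- The leg on which a point lies. -/
  leg : ι
  /-- The distance of a point from the beginning of its leg. -/
  height : ℕ

namespace Spider

variable {ι : Type*}

open Classical in
/-- The distance on the spider: points on distinct legs are joined through the bodies. -/
def natDist (x y : Spider ι) : ℕ :=
  if x.leg = y.leg then (x.height - y.height) + (y.height - x.height) else x.height + y.height + 1

theorem natDist_of_leg_eq {x y : Spider ι} (h : x.leg = y.leg) :
    natDist x y = (x.height - y.height) + (y.height - x.height) := if_pos h

theorem natDist_of_leg_ne {x y : Spider ι} (h : x.leg ≠ y.leg) :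
    natDist x y = x.height + y.height + 1 := if_neg h

theorem natDist_self (x : Spider ι) : natDist x x = 0 := by
  simp [natDist_of_leg_eq]

theorem natDist_comm (x y : Spider ι) : natDist x y = natDist y x := by
  unfold natDist
  grind

theorem natDist_triangle (x y z : Spider ι) : natDist x z ≤ natDist x y + natDist y z := by
  unfold natDist
  grind

/-- The `+ 1` between distinct legs keeps their height-zero points apart; without it `natDist` would
be only a pseudometric. -/
theorem eq_of_natDist_eq_zero {x y : Spider ι} (h : natDist x y = 0) : x = y := by
  unfold natDist at h
  ext <;> grind

/-- Height is 1-Lipschitz, which confines balls to bands. -/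
theorem height_le_add_natDist (x y : Spider ι) : y.height ≤ x.height + natDist x y := by
  unfold natDist
  grind

instance : MetricSpace (Spider ι) where
  dist x y := natDist x y
  dist_self x := by simp [natDist_self]
  dist_comm x y := by rw [natDist_comm]
  dist_triangle x y z := by exact_mod_cast natDist_triangle x y z
  eq_of_dist_eq_zero h := eq_of_natDist_eq_zero (by exact_mod_cast h)

theorem dist_eq (x y : Spider ι) : dist x y = natDist x y := rfl

instance : DiscreteTopology (Spider ι) := by
  refine .of_forall_le_dist one_pos fun x y hxy => ?_
  change (1 : ℝ) ≤ natDist x y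
  exact_mod_cast Nat.one_le_iff_ne_zero.2 fun h => hxy (eq_of_natDist_eq_zero h)

instance [Nonempty ι] : Infinite (Spider ι) :=
  Infinite.of_injective (fun n : ℕ => (⟨Classical.arbitrary ι, n⟩ : Spider ι)) fun _ _ h =>
    congrArg height h

/-- The points with heights between `a` and `b`. -/
def band (ι : Type*) (a b : ℕ) : Set (Spider ι) := {z | a ≤ z.height ∧ z.height ≤ b}

theorem band_eq_image (a b : ℕ) :
    band ι a b = (fun p : ι × ℕ => (⟨p.1, p.2⟩ : Spider ι)) '' (Set.univ ×ˢ Set.Icc a b) := by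
  ext z
  constructor
  · exact fun h => ⟨(z.leg, z.height), ⟨trivial, h⟩, rfl⟩
  · rintro ⟨p, ⟨-, h⟩, rfl⟩
    exact h

theorem closedBall_subset_band (x : Spider ι) {R : ℝ} (hR : 0 ≤ R) :
    Metric.closedBall x R ⊆ band ι (x.height - ⌊R⌋₊) (x.height + ⌊R⌋₊) := by
  intro y hy
  rw [Metric.mem_closedBall, dist_eq, ← Nat.le_floor_iff hR] at hy
  have h1 := height_le_add_natDist x y
  have h2 := height_le_add_natDist y x
  rw [natDist_comm] at h1
  exact ⟨by omega, by omega⟩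

/-- Annuli in the spider lie in the union of three bands of bounded width. -/
theorem annulus_subset (x : Spider ι) (M r : ℕ) :
    {z | M < natDist x z ∧ natDist x z ≤ M + 2 * r} ⊆
      band ι (x.height + M) (x.height + M + 2 * r) ∪
        band ι (x.height - M - 2 * r) (x.height - M) ∪
        band ι (M - x.height) (M + 2 * r - x.height) := by
  rintro z ⟨h1, h2⟩
  simp only [band, Set.mem_union, Set.mem_ofPred_eq]
  -- On the leg of `x`, the point `z` is above or below `x`, giving the first two bands; on any
  -- other leg the sum of the heights is constrained, giving the third.
  by_cases h : x.leg = z.leg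
  · rw [natDist_of_leg_eq h] at h1 h2
    omega
  · rw [natDist_of_leg_ne h] at h1 h2
    omega

/-- A permutation of the legs, acting on the spider. -/
def permLegs (ι : Type*) : Equiv.Perm ι →* Equiv.Perm (Spider ι) where
  toFun σ :=
    { toFun := fun x => ⟨σ x.leg, x.height⟩
      invFun := fun x => ⟨σ.symm x.leg, x.height⟩
      left_inv := fun x => by simp
      right_inv := fun x => by simp }
  map_one' := rfl
  map_mul' _ _ := rfl

theorem isometry_permLegs (σ : Equiv.Perm ι) : Isometry (permLegs ι σ) := by
  refine Isometry.of_dist_eq fun x y => congrArg Nat.cast ?_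
  by_cases h : x.leg = y.leg
  · rw [natDist_of_leg_eq h]
    exact natDist_of_leg_eq (congrArg σ h)
  · rw [natDist_of_leg_ne h]
    exact natDist_of_leg_ne (σ.injective.ne h)

/-! ### Finitely many legs: bounded geometry, coarse disjointness of legs, property A -/

variable [Finite ι]

theorem finite_band (a b : ℕ) : (band ι a b).Finite := by
  rw [band_eq_image]
  exact (Set.finite_univ.prod (Set.finite_Icc a b)).image _

theorem ncard_band_le (a b : ℕ) : (band ι a b).ncard ≤ Nat.card ι * (b + 1 - a) := by
  rw [band_eq_image]
  refine (Set.ncard_image_le (Set.finite_univ.prod (Set.finite_Icc a b))).trans_eq ?_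
  rw [Set.ncard_prod, Set.ncard_univ, ← Finset.coe_Icc, Set.ncard_coe_finset, Nat.card_Icc]

instance : BoundedGeometry (Spider ι) where
  bound R hR := by
    refine ⟨Nat.card ι * (2 * ⌊R⌋₊ + 1), fun x => ?_⟩
    have h := closedBall_subset_band x hR.le
    refine ⟨(finite_band _ _).subset h, (Set.ncard_le_ncard h (finite_band _ _)).trans
      ((ncard_band_le _ _).trans (Nat.mul_le_mul_left _ (by omega)))⟩

/-- Only finitely many pairs of points on different legs are at a given bounded distance. -/
theorem finite_pairs_leg_ne (R : ℝ) :
    {p : Spider ι × Spider ι | dist p.1 p.2 < R ∧ p.1.leg ≠ p.2.leg}.Finite := by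
  refine ((finite_band 0 ⌊R⌋₊).prod (finite_band 0 ⌊R⌋₊)).subset ?_
  rintro ⟨x, y⟩ ⟨hd, hne⟩
  -- Between different legs the distance exceeds the sum of the heights, so both heights are bounded
  -- by `R`.
  rw [dist_eq, natDist_of_leg_ne hne] at hd
  have h := Nat.le_floor hd.le
  exact ⟨⟨by omega, by omega⟩, ⟨by omega, by omega⟩⟩

theorem finite_annulus (x : Spider ι) (M r : ℕ) :
    {z | M < natDist x z ∧ natDist x z ≤ M + 2 * r}.Finite :=
  (((finite_band _ _).union (finite_band _ _)).union (finite_band _ _)).subset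
    (annulus_subset x M r)

/-- The bound does not depend on `x` or `M`: shells of fixed thickness stay bounded while balls
grow, which is what property A needs. -/
theorem ncard_annulus_le (x : Spider ι) (M r : ℕ) :
    {z | M < natDist x z ∧ natDist x z ≤ M + 2 * r}.ncard ≤ 3 * (Nat.card ι * (2 * r + 1)) := by
  refine (Set.ncard_le_ncard (annulus_subset x M r)
    (((finite_band _ _).union (finite_band _ _)).union (finite_band _ _))).trans ?_
  refine (Set.ncard_union_le _ _).trans ?_
  have h : ∀ a b, b + 1 - a ≤ 2 * r + 1 → (band ι a b).ncard ≤ Nat.card ι * (2 * r + 1) :=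
    fun a b hab => (ncard_band_le a b).trans (Nat.mul_le_mul_left _ hab)
  have h1 := Set.ncard_union_le (band ι (x.height + M) (x.height + M + 2 * r))
    (band ι (x.height - M - 2 * r) (x.height - M))
  have h2 := h (x.height + M) (x.height + M + 2 * r) (by omega)
  have h3 := h (x.height - M - 2 * r) (x.height - M) (by omega)
  have h4 := h (M - x.height) (M + 2 * r - x.height) (by omega)
  omega

/-- A spider with finitely many legs has property A, witnessed by large balls. -/
theorem propertyA : PropertyA (Spider ι) := by
  intro ε hε R hR
  set r := ⌊R⌋₊
  -- The numerator is the shell bound for the symmetric difference; the intersection will have more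
  -- than `M` points.
  obtain ⟨M, hM⟩ := exists_nat_ge (((3 * (Nat.card ι * (2 * r + 1)) : ℕ) : ℝ) / ε)
  have hinj : Function.Injective fun z : Spider ι => (z, (0 : ℕ)) := fun _ _ h =>
    congrArg Prod.fst h
  -- The extra `r` ensures that the ball of radius `M` about `x` lies in `B y` for every `y` within
  -- `r` of `x`.
  let B : Spider ι → Set (Spider ι) := fun x => {z | natDist x z ≤ M + r}
  have hB : ∀ x, (B x).Finite := fun x =>
    ((finite_band _ _).subset (closedBall_subset_band x (Nat.cast_nonneg (M + r)))).subset
      fun z hz => by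
        rw [Metric.mem_closedBall, dist_comm, dist_eq]
        exact_mod_cast hz
  refine ⟨fun x => (fun z => (z, 0)) '' B x, (M + r : ℕ), fun x => ⟨(hB x).image _, ?_⟩, ?_, ?_⟩
  · exact Set.Nonempty.image _ ⟨x, by simp [B, natDist_self]⟩
  · rintro x _ ⟨z, hz, rfl⟩
    rw [Metric.mem_closedBall, dist_comm, dist_eq]
    exact_mod_cast hz
  · intro x y hxy
    have hxy' : natDist x y ≤ r := Nat.le_floor hxy
    -- Legs are infinite upwards, so the `M + 1` points from `x` outwards along its leg bound the
    -- intersection from below.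
    have hseg : (fun n : ℕ => (⟨x.leg, x.height + n⟩ : Spider ι)) '' Set.Iic M ⊆ B x ∩ B y := by
      rintro _ ⟨n, hn, rfl⟩
      have h1 : natDist x ⟨x.leg, x.height + n⟩ ≤ M := by
        rw [natDist_of_leg_eq (x := x) (y := ⟨x.leg, x.height + n⟩) rfl]
        have := Set.mem_Iic.1 hn
        simp only
        omega
      have h2 := natDist_triangle y x ⟨x.leg, x.height + n⟩
      rw [natDist_comm y x] at h2
      exact ⟨by simp only [B, Set.mem_ofPred_eq]; omega, by simp only [B, Set.mem_ofPred_eq]; omega⟩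
    have hcard : M + 1 ≤ (B x ∩ B y).ncard := by
      refine le_trans (le_of_eq ?_) (Set.ncard_le_ncard hseg ((hB x).inter_of_left _))
      rw [Set.ncard_image_of_injective _ fun a b h => by simpa using h, ← Finset.coe_Iic,
        Set.ncard_coe_finset, Nat.card_Iic]
    -- The distances of `z` from `x` and from `y` differ by at most `r` and lie on opposite sides of
    -- the threshold `M + r`.
    have hsymm : symmDiff (B x) (B y) ⊆ {z | M < natDist x z ∧ natDist x z ≤ M + 2 * r} := by
      have hyx : natDist y x ≤ r := natDist_comm x y ▸ hxy'
      rintro z (⟨h1, h2⟩ | ⟨h1, h2⟩) <;> simp only [B, Set.mem_ofPred_eq] at h1 h2 ⊢ <;>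
        have h3 := natDist_triangle x y z <;> have h4 := natDist_triangle y x z <;> omega
    have hscard := (Set.ncard_le_ncard hsymm (finite_annulus x M r)).trans (ncard_annulus_le x M r)
    rw [← Set.image_inter hinj, ← Set.image_symmDiff hinj, Set.ncard_image_of_injective _ hinj,
      Set.ncard_image_of_injective _ hinj]
    refine ⟨((Set.nonempty_of_ncard_ne_zero (by omega)).image _), ?_⟩
    have hpos : (0 : ℝ) < (B x ∩ B y).ncard := by exact_mod_cast (by omega)
    rw [div_le_iff₀ hpos]
    rw [div_le_iff₀ hε] at hM
    calc ((symmDiff (B x) (B y)).ncard : ℝ) ≤ (3 * (Nat.card ι * (2 * r + 1)) : ℕ) := by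
          exact_mod_cast hscard
      _ ≤ M * ε := hM
      _ ≤ (B x ∩ B y).ncard * ε := by
        gcongr
        omega
      _ = _ := mul_comm _ _

end Spider
end

/-! ### The spider with one leg for each group element -/

theorem theorem1p5 {G : Type*} [Group G] [Finite G] (ω : G → G → G → Circle)
    (hω : IsNormalizedThreeCocycle ω) :
    ∃ (X : Type) (_ : MetricSpace X) (_ : BoundedGeometry X),
      DiscreteTopology X ∧ Infinite X ∧ PropertyA X ∧
      ∀ (H : Type*) [NormedAddCommGroup H] [InnerProductSpace ℂ H] [CompleteSpace H]
        [TopologicalSpace.SeparableSpace H], ¬ FiniteDimensional ℂ H →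
        Nonempty (AnomalousAction ω (RoeCorona X H)) := by
  -- Legs are indexed by `Fin n` instead of `G` so that the space lives in `Type` whatever the
  -- universe of `G`.
  obtain ⟨n, ⟨e⟩⟩ := Finite.exists_equiv_fin G
  have : Nonempty (Fin n) := ⟨e 1⟩
  refine ⟨Spider (Fin n), inferInstance, inferInstance, inferInstance, inferInstance,
    Spider.propertyA, fun H _ _ _ _ _ => ?_⟩
  -- Left translation of `G`, transported along `e` to the legs; the map `x ↦ e.symm x.leg` is then
  -- equivariant.
  let σ : G →* Equiv.Perm (Spider (Fin n)) :=
    (Spider.permLegs (Fin n)).comp (e.permCongrHom.toMonoidHom.comp (MulAction.toPermHom G G))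
  refine nonempty_anomalousAction_roeCorona hω σ (fun g => Spider.isometry_permLegs _)
    (fun x => e.symm x.leg) (fun g x => ?_) fun R => (Spider.finite_pairs_leg_ne R).subset ?_
  · change e.symm (e (g * e.symm x.leg)) = g * e.symm x.leg
    rw [e.symm_apply_apply]
  · rintro p ⟨hd, hne⟩
    exact ⟨hd, fun h => hne (by rw [h])⟩
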